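/- For complex $\mu,\nu$ and real $x>0$, $x\neq 1$, let $$P_\nu^{-\mu}(x)=\frac{2^{-\nu}\,|1-x|^{\mu/2}\,(1+x)^{\nu-\mu/2}}{\Gamma(1+\mu)}\;F\Bigl(-\nu,\mu-\nu;1+\mu;\frac{x-1}{x+1}\Bigr)=\Bigl|\frac{1-x}{1+x}\Bigr|^{\mu/2}\frac{F\bigl(-\nu,\nu+1;1+\mu;\frac{1-x}{2}\bigr)}{\Gamma(1+\mu)},$$ where $F$ is the Gauss hypergeometric function and $F(a,b;c;z)/\Gamma(c)$ is understood as the entire function $\sum_{k\ge 0}\frac{(a)_k(b)_k}{\Gamma(c+k)\,k!}z^k$ of the parameters ($|z|<1$, continued analytically in $z$). This is the Ferrers function of the first kind for $0<x<1$ and the associated Legendre function of the first kind for $x>1$. Here $(a)_n=a(a+1)\cdots(a+n-1)$. **Theorem.** Let $\mu,\nu\in\mathbb{C}$. There are the following mutually inverse, absolutely convergent series. (a) The expansion $$P_\nu^{-\mu}(x)=\sum_{n=0}^\infty \frac{\left(\frac{\mu+\nu+1}{2}\right)_n(\nu+1)_n}{n!}\,(-2)^n\,(1-x^2)^{n/2}\,x^{-\nu-n-1}\,P_{\nu+n}^{-\mu-n}\!\left(\frac1x\right)$$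 holds for every $x\in(2^{-1/2},1)$; it holds at $x=2^{-1/2}$ if $\operatorname{Re}(3\nu-\mu)<-1$; and it holds for every $x\in(0,1)$ if $-\nu\in\{1,2,3,\dots\}$ or $-\frac{\mu+\nu+1}{2}\in\{0,1,2,\dots\}$ (in which case the series terminates). (b) For every $x\in(0,1)$, $$x^{-\nu-1}P_\nu^{-\mu}\!\left(\frac1x\right)=\sum_{n=0}^\infty \frac{\left(\frac{\mu+\nu+1}{2}\right)_n(\nu+1)_n}{n!}\,2^n\,(1-x^2)^{n/2}\,P_{\nu+n}^{-\mu-n}(x).$$ The series are mutually inverse in the following sense: with $k_n^{\pm}(\nu,\mu)=\frac{1}{n!}\left(\frac{\mu+\nu+1}{2}\right)_n(\nu+1)_n(\pm2)^n(1-x^2)^{n/2}$, for all $x\in(0,1)$ and $N\ge 0$, $$\sum_{j=0}^N k_j^{-}(\nu,\mu)\,k_{N-j}^{+}(\nu+j,\mu+j)=\sum_{j=0}^N k_j^{+}(\nu,\mu)\,k_{N-j}^{-}(\nu+j,\mu+j)=\begin{cases}1,&N=0,\\0,&N\ge1.\end{cases}$$ -/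

import Mathlib

noncomputable section

/-- The Gauss hypergeometric function `F(a, b; c; z)` divided by `Γ(c)`, given for `|z| < 1` by
`∑ₖ (a)ₖ (b)ₖ zᵏ / (Γ(c + k) k!)`, which is entire in `a`, `b`, `c`. The reciprocal `1 / Γ(c + k)`
vanishes at the poles of `Γ`, in agreement with the convention `Complex.Gamma (-m) = 0`. -/
def regularizedHypergeometric (a b c z : ℂ) : ℂ :=
  ∑' k : ℕ, (ascPochhammer ℂ k).eval a * (ascPochhammer ℂ k).eval b /
    (Complex.Gamma (c + k) * (k.factorial : ℂ)) * z ^ k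

/-- `legendreP ν μ x` is the function of the first kind `P_ν^{-μ}(x)` of degree `ν` and order `-μ`
at a real argument `x > 0`: the Ferrers function for `0 < x < 1`, and the associated Legendre
function for `x > 1`. In both cases
`P_ν^{-μ}(x) = 2^{-ν} |1 - x|^{μ/2} (1 + x)^{ν - μ/2} F(-ν, μ - ν; 1 + μ; (x-1)/(x+1)) / Γ(1 + μ)`,
where `|(x-1)/(x+1)| < 1` for every `x > 0`. By the Pfaff transformation this is
`|(1-x)/(1+x)|^{μ/2} F(-ν, ν + 1; 1 + μ; (1-x)/2) / Γ(1 + μ)`. -/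
def legendreP (ν μ : ℂ) (x : ℝ) : ℂ :=
  (2 : ℂ) ^ (-ν) * ((|1 - x| : ℝ) : ℂ) ^ (μ / 2) * ((1 + x : ℝ) : ℂ) ^ (ν - μ / 2) *
    regularizedHypergeometric (-ν) (μ - ν) (1 + μ) (((x - 1) / (x + 1) : ℝ) : ℂ)

/-- The coefficient `((μ+ν+1)/2)ₙ (ν+1)ₙ sⁿ (1 - x²)^{n/2} / n!`
(used for `s = -2` and for `s = 2`). -/
def legendreSeriesCoeff (s ν μ : ℂ) (x : ℝ) (n : ℕ) : ℂ :=
  (ascPochhammer ℂ n).eval ((μ + ν + 1) / 2) * (ascPochhammer ℂ n).eval (ν + 1) / (n.factorial : ℂ) *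
    s ^ n * ((Real.sqrt (1 - x ^ 2) ^ n : ℝ) : ℂ)

end

/-! Put `t = (1 - x) / (1 + x)`. Replacing `x` by `1 / x` replaces `t` by `-t`, so up to elementary
factors the two Legendre functions are one function `F(-ν, μ-ν; 1+μ; ·) / Γ(1+μ)`, taken at `-t` and
at `t`. Raising `ν` and `μ` together by `n` keeps `μ - ν` and multiplies the elementary factor by
`(√(1-x²)/2)ⁿ`. Hence both expansions are the single identity `∑ₙ legendreTerm ν μ n z = legendreSum
ν μ z`: `z = t` gives the series of Ferrers functions and `z = -t` the series in `1 / x`, where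
`4z/(1+z)²` equals `1-x²` and `-(1-x²)/x²` respectively.

Near `z = 0`, Euler's transformation (`regularizedHypergeometric_euler`) removes the denominators
`(1+z)^(2n)`. The resulting double power series can be rearranged, and its coefficients are matched
by `sum_pochhammer_quadratic` with `A = μ + ν + 1`.

The identity then spreads by analytic continuation (`hasSum_legendreTerm`). On a disc of radius `r <
1` the hypergeometric factors are `O(1/Γ(1+μ+n))`, so where `|4z/(1+z)²| ≤ w` the terms are
dominated by a multiple of `n^((Re(3ν-μ)-1)/2) wⁿ`. This is summable for `w < 1`, and for `w = 1`
when `Re(3ν-μ) < -1`; a terminating series needs no bound on `w`. The region is star-shaped about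
`0`, and uniform convergence carries the identity to its boundary.

The inversion relations are the binomial theorem for `(s + (-s))^N`. -/

open Filter Asymptotics Finset
open scoped Topology

/-! ### Rising factorials and finite summation identities -/

/-- The rising factorial `(s)ₙ = s (s + 1) ⋯ (s + n - 1)`. -/
noncomputable def pochhammer (s : ℂ) (n : ℕ) : ℂ := (ascPochhammer ℂ n).eval s

@[simp] lemma pochhammer_zero (s : ℂ) : pochhammer s 0 = 1 := by simp [pochhammer]

lemma pochhammer_succ (s : ℂ) (n : ℕ) : pochhammer s (n + 1) = pochhammer s n * (s + n) := by
  simp [pochhammer, ascPochhammer_succ_eval]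

lemma pochhammer_succ_left (s : ℂ) (n : ℕ) :
    pochhammer s (n + 1) = s * pochhammer (s + 1) n := by
  simp [pochhammer, ascPochhammer_succ_left, Polynomial.eval_comp]

lemma pochhammer_add (s : ℂ) (n m : ℕ) :
    pochhammer s (n + m) = pochhammer s n * pochhammer (s + n) m := by
  induction m with
  | zero => simp
  | succ m ih => rw [← add_assoc, pochhammer_succ, ih, pochhammer_succ]; push_cast; ring

lemma inv_Gamma_eq_pochhammer_mul (s : ℂ) (n : ℕ) :
    (Complex.Gamma s)⁻¹ = pochhammer s n * (Complex.Gamma (s + n))⁻¹ := by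
  induction n with
  | zero => simp
  | succ n ih =>
    rw [ih, Complex.one_div_Gamma_eq_self_mul_one_div_Gamma_add_one (s + n), pochhammer_succ]
    push_cast
    rw [add_assoc s]; ring

lemma factorial_cast_ne_zero (n : ℕ) : (n.factorial : ℂ) ≠ 0 :=
  Nat.cast_ne_zero.2 n.factorial_ne_zero

/-- The Pfaff–Saalschütz sum, in a form free of poles. -/
theorem sum_pochhammer_saalschutz (a b c : ℂ) (N : ℕ) :
    ∑ k ∈ range (N + 1), pochhammer (a + b - c) (N - k) / ((N - k).factorial : ℂ) *
      (pochhammer (c - a) k * pochhammer (c - b) k * pochhammer (c + k) (N - k) /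
        (k.factorial : ℂ)) =
      pochhammer a N * pochhammer b N / (N.factorial : ℂ) := by
  set T : ℕ → ℕ → ℂ := fun N k => pochhammer (a + b - c) (N - k) / ((N - k).factorial : ℂ) *
      (pochhammer (c - a) k * pochhammer (c - b) k * pochhammer (c + k) (N - k) /
        (k.factorial : ℂ)) with hT
  change ∑ k ∈ range (N + 1), T N k = _
  -- Creative telescoping: the summand satisfies the first-order recurrence in `N` of the right-hand
  -- side up to a difference in `k`, so these partial sums have a closed form.
  have partialSum : ∀ (N m : ℕ), m ≤ N →
      ∑ k ∈ range (m + 1), ((N + 1) * T (N + 1) k - (a + N) * (b + N) * T N k) =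
        -((c - a + m) * (c - b + m) * T N m) := by
    intro N m
    induction m with
    | zero =>
      intro _
      have h0 := factorial_cast_ne_zero N
      have h1 : (N : ℂ) + 1 ≠ 0 := by exact_mod_cast Nat.succ_ne_zero N
      simp only [hT, zero_add, sum_range_one, Nat.sub_zero, Nat.factorial_zero, pochhammer_zero,
        pochhammer_succ, Nat.factorial_succ]
      push_cast
      field_simp
      ring
    | succ m ih =>
      intro hm
      obtain ⟨d, rfl⟩ := Nat.exists_eq_add_of_le hm
      rw [sum_range_succ, ih (by omega)]
      have h0 := factorial_cast_ne_zero d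
      have h1 : (d : ℂ) + 1 ≠ 0 := by exact_mod_cast Nat.succ_ne_zero d
      have h2 := factorial_cast_ne_zero m
      have h3 : (m : ℂ) + 1 ≠ 0 := by exact_mod_cast Nat.succ_ne_zero m
      simp only [hT, show m + 1 + d - m = d + 1 by omega, show m + 1 + d + 1 - (m + 1) = d + 1 by omega,
        show m + 1 + d - (m + 1) = d by omega]
      rw [pochhammer_succ_left (c + m) d, pochhammer_succ (c + ((m + 1 : ℕ) : ℂ)) d,
        pochhammer_succ (a + b - c) d, pochhammer_succ (c - a), pochhammer_succ (c - b),
        Nat.factorial_succ, Nat.factorial_succ]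
      push_cast
      rw [← add_assoc c]
      generalize pochhammer (c + m + 1) d = P
      field_simp
      ring
  induction N with
  | zero => simp [hT]
  | succ N ih =>
    -- At `m = N` the closed form cancels the one term `k = N + 1` that the recurrence leaves out.
    have h := partialSum N N le_rfl
    rw [sum_sub_distrib, ← mul_sum, ← mul_sum, ih] at h
    have h1 : (N : ℂ) + 1 ≠ 0 := by exact_mod_cast Nat.succ_ne_zero N
    have h2 := factorial_cast_ne_zero N
    rw [sum_range_succ]
    apply mul_left_cancel₀ h1
    rw [mul_add, sub_eq_iff_eq_add.1 h]
    simp only [hT, Nat.sub_self, pochhammer_zero, Nat.factorial_zero, pochhammer_succ,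
      Nat.factorial_succ]
    push_cast
    field_simp
    ring

/-- The coefficients of `(1 - s)^{-A} = (1 + s)^{-A} (1 - 4 s / (1 + s)²)^{-A/2}`. -/
theorem sum_pochhammer_quadratic (A : ℂ) (N : ℕ) :
    ∑ n ∈ range (N + 1), pochhammer (A / 2) n * 4 ^ n / (n.factorial : ℂ) *
      (pochhammer (A + 2 * n) (N - n) * (-1) ^ (N - n) / ((N - n).factorial : ℂ)) =
      pochhammer A N / (N.factorial : ℂ) := by
  set T : ℕ → ℕ → ℂ := fun N n => pochhammer (A / 2) n * 4 ^ n / (n.factorial : ℂ) *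
      (pochhammer (A + 2 * n) (N - n) * (-1) ^ (N - n) / ((N - n).factorial : ℂ)) with hT
  change ∑ k ∈ range (N + 1), T N k = _
  -- The same telescoping, now for the recurrence with factor `(A + N) / (N + 1)`.
  have partialSum : ∀ (N m : ℕ), m ≤ N →
      ∑ k ∈ range (m + 1), ((N + 1) * T (N + 1) k - (A + N) * T N k) =
        -(2 * (A + N + m) * T N m) := by
    intro N m
    induction m with
    | zero =>
      intro _
      have h0 := factorial_cast_ne_zero N
      have h1 : (N : ℂ) + 1 ≠ 0 := by exact_mod_cast Nat.succ_ne_zero N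
      simp only [hT, zero_add, sum_range_one, Nat.sub_zero, Nat.factorial_zero, pochhammer_zero,
        pochhammer_succ, Nat.factorial_succ, pow_succ]
      push_cast
      field_simp
      ring
    | succ m ih =>
      intro hm
      obtain ⟨d, rfl⟩ := Nat.exists_eq_add_of_le hm
      rw [sum_range_succ, ih (by omega)]
      have h0 := factorial_cast_ne_zero d
      have h1 : (d : ℂ) + 1 ≠ 0 := by exact_mod_cast Nat.succ_ne_zero d
      have h2 := factorial_cast_ne_zero m
      have h3 : (m : ℂ) + 1 ≠ 0 := by exact_mod_cast Nat.succ_ne_zero m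
      -- Both sides are `(A + 2m)_{d+2}`, split off at the last factor and at the first two.
      have hP : pochhammer (A + 2 * m) (d + 1) * (A + 2 * m + 1 + d) =
          (A + 2 * m) * (A + 2 * m + 1) * pochhammer (A + 2 * (m + 1)) d := by
        have e1 := pochhammer_succ (A + 2 * m) (d + 1)
        have e2 := pochhammer_succ_left (A + 2 * m) (d + 1)
        rw [pochhammer_succ_left (A + 2 * m + 1) d] at e2
        rw [show A + 2 * (m : ℂ) + 1 + 1 = A + 2 * (m + 1) by ring] at e2
        rw [e1] at e2
        push_cast at e2
        linear_combination e2
      simp only [hT, show m + 1 + d - m = d + 1 by omega, show m + 1 + d + 1 - (m + 1) = d + 1 by omega,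
        show m + 1 + d - (m + 1) = d by omega]
      rw [pochhammer_succ (A + 2 * ((m + 1 : ℕ) : ℂ)) d,
        pochhammer_succ (A / 2), Nat.factorial_succ, Nat.factorial_succ, pow_succ, pow_succ]
      push_cast
      generalize pochhammer (A + 2 * (m + 1)) d = Q at *
      generalize pochhammer (A + 2 * m) (d + 1) = P at *
      field_simp
      linear_combination (4 * pochhammer (A / 2) m * (m + 1)) * hP
  induction N with
  | zero => simp [hT]
  | succ N ih =>
    have h := partialSum N N le_rfl
    rw [sum_sub_distrib, ← mul_sum, ← mul_sum, ih] at h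
    have h1 : (N : ℂ) + 1 ≠ 0 := by exact_mod_cast Nat.succ_ne_zero N
    have h2 := factorial_cast_ne_zero N
    rw [sum_range_succ]
    apply mul_left_cancel₀ h1
    rw [mul_add, sub_eq_iff_eq_add.1 h]
    simp only [hT, Nat.sub_self, pochhammer_zero, Nat.factorial_zero, pochhammer_succ,
      Nat.factorial_succ, pow_succ]
    push_cast
    field_simp
    ring

/-! ### The inversion relations -/

lemma sum_neg_pow_mul_pow_div_factorial (s : ℂ) (N : ℕ) :
    ∑ j ∈ range (N + 1), s ^ j / (j.factorial : ℂ) * ((-s) ^ (N - j) / ((N - j).factorial : ℂ)) =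
      if N = 0 then 1 else 0 := by
  have h : (N.factorial : ℂ) * ∑ j ∈ range (N + 1),
      s ^ j / (j.factorial : ℂ) * ((-s) ^ (N - j) / ((N - j).factorial : ℂ)) = (s + -s) ^ N := by
    rw [add_pow, mul_sum]
    refine sum_congr rfl fun j hj => ?_
    rw [Nat.cast_choose ℂ (Nat.lt_succ_iff.1 (mem_range.1 hj))]
    have h1 := factorial_cast_ne_zero j
    have h2 := factorial_cast_ne_zero (N - j)
    field_simp
  rcases Nat.eq_zero_or_pos N with rfl | hN
  · simp
  · rw [if_neg hN.ne']
    rw [add_neg_cancel, zero_pow hN.ne'] at h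
    exact (mul_eq_zero.1 h).resolve_left (factorial_cast_ne_zero N)

/-- Raising both `ν` and `μ` by `j` shifts `(μ+ν+1)/2` and `ν+1` by exactly `j`, so the rising
factorials join to `(·)_N`. Only the binomial terms in `s` and `-s` still depend on `j`. -/
theorem sum_legendreSeriesCoeff_mul (s ν μ : ℂ) (x : ℝ) (N : ℕ) :
    ∑ j ∈ range (N + 1),
      legendreSeriesCoeff s ν μ x j * legendreSeriesCoeff (-s) (ν + j) (μ + j) x (N - j) =
        if N = 0 then 1 else 0 := by
  have h : ∀ j ∈ range (N + 1),
      legendreSeriesCoeff s ν μ x j * legendreSeriesCoeff (-s) (ν + j) (μ + j) x (N - j) =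
      pochhammer ((μ + ν + 1) / 2) N * pochhammer (ν + 1) N * ((Real.sqrt (1 - x ^ 2) ^ N : ℝ) : ℂ) *
      (s ^ j / (j.factorial : ℂ) * ((-s) ^ (N - j) / ((N - j).factorial : ℂ))) := by
    intro j hj
    obtain ⟨d, rfl⟩ := Nat.exists_eq_add_of_le (Nat.lt_succ_iff.1 (mem_range.1 hj))
    rw [pochhammer_add, pochhammer_add, pow_add]
    simp only [legendreSeriesCoeff, add_tsub_cancel_left, pochhammer]
    rw [show (μ + j + (ν + j) + 1) / 2 = (μ + ν + 1) / 2 + j by ring,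
      show ν + j + 1 = ν + 1 + j by ring]
    push_cast
    ring
  rw [sum_congr rfl h, ← mul_sum, sum_neg_pow_mul_pow_div_factorial]
  rcases Nat.eq_zero_or_pos N with rfl | hN
  · simp
  · simp [hN.ne']

/-! ### Growth of rising factorials and of `1 / Γ` -/

lemma isBigO_natCast_add (s : ℂ) : (fun n : ℕ => s + n) =O[atTop] fun n : ℕ => (n : ℝ) := by
  refine IsBigO.of_bound (‖s‖ + 1) ?_
  filter_upwards [eventually_ge_atTop 1] with n hn
  have : (1 : ℝ) ≤ n := by exact_mod_cast hn
  calc ‖s + n‖ ≤ ‖s‖ + n := by simpa using norm_add_le s (n : ℂ)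
    _ ≤ (‖s‖ + 1) * ‖(n : ℝ)‖ := by
      rw [Real.norm_natCast]; nlinarith [norm_nonneg s]

lemma isBigO_inv_natCast_add (s : ℂ) :
    (fun n : ℕ => (s + n)⁻¹) =O[atTop] fun n : ℕ => (n : ℝ)⁻¹ := by
  refine IsBigO.of_bound 2 ?_
  filter_upwards [eventually_ge_atTop 1, eventually_ge_atTop ⌈2 * ‖s‖⌉₊] with n hn hs
  have h1 : (1 : ℝ) ≤ n := by exact_mod_cast hn
  have h2 : 2 * ‖s‖ ≤ n := (Nat.le_ceil _).trans (by exact_mod_cast hs)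
  have h3 : (n : ℝ) / 2 ≤ ‖s + n‖ := by
    have := norm_sub_le (s + n) s
    rw [add_sub_cancel_left, Complex.norm_natCast] at this
    linarith
  rw [norm_inv, norm_inv, Real.norm_natCast]
  calc ‖s + n‖⁻¹ ≤ ((n : ℝ) / 2)⁻¹ := inv_anti₀ (by positivity) h3
    _ = 2 * (n : ℝ)⁻¹ := by field_simp

lemma norm_natCast_cpow (n : ℕ) (hn : 1 ≤ n) (s : ℂ) : ‖(n : ℂ) ^ s‖ = (n : ℝ) ^ s.re :=
  Complex.norm_natCast_cpow_of_pos hn s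

lemma GammaSeq_eq_pochhammer (s : ℂ) (n : ℕ) :
    Complex.GammaSeq s n = (n : ℂ) ^ s * (n.factorial : ℂ) / pochhammer s (n + 1) := by
  rw [Complex.GammaSeq]
  congr 1
  induction n with
  | zero => simp [pochhammer_succ]
  | succ n ih => rw [prod_range_succ, ih, ← pochhammer_succ]

/-- Gauss's limit `n^s n! / (s)_{n+1} → Γ(s)` gives the growth away from the poles of `Γ`; at a pole
`(s)ₙ` is eventually zero. -/
lemma isBigO_pochhammer (s : ℂ) :
    (fun n : ℕ => pochhammer s n) =O[atTop]
      fun n : ℕ => (n : ℝ) ^ (s.re - 1) * (n.factorial : ℝ) := by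
  by_cases hs : ∃ m : ℕ, s = -m
  · obtain ⟨m, rfl⟩ := hs
    refine IsBigO.of_bound 0 ?_
    filter_upwards [eventually_gt_atTop m] with n hn
    obtain ⟨d, rfl⟩ := Nat.exists_eq_add_of_lt hn
    rw [add_right_comm, pochhammer_add, pochhammer_succ]
    simp
  · push Not at hs
    have hG := Complex.Gamma_ne_zero hs
    have h1 := ((Complex.GammaSeq_tendsto_Gamma s).inv₀ hG).isBigO_one ℝ
    have h2 : (fun n : ℕ => (n : ℂ) ^ s * (n.factorial : ℂ)) =O[atTop]
        fun n : ℕ => (n : ℝ) ^ s.re * (n.factorial : ℝ) := by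
      refine IsBigO.of_bound 1 ?_
      filter_upwards [eventually_ge_atTop 1] with n hn
      rw [norm_mul, norm_natCast_cpow n hn, Complex.norm_natCast, one_mul]
      exact le_abs_self _
    refine ((h1.mul h2).mul (isBigO_inv_natCast_add s)).congr' ?_ ?_
    · filter_upwards [eventually_ge_atTop 1] with n hn
      have hn' : (n : ℂ) ≠ 0 := by exact_mod_cast (Nat.one_le_iff_ne_zero.1 hn)
      have h3 : (n : ℂ) ^ s ≠ 0 := by simp [Complex.cpow_eq_zero_iff, hn']
      have h4 := factorial_cast_ne_zero n
      have h5 : s + n ≠ 0 := fun h => hs n (eq_neg_of_add_eq_zero_left h)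
      rw [GammaSeq_eq_pochhammer, pochhammer_succ]
      field_simp
    · filter_upwards [eventually_ge_atTop 1] with n hn
      have hn' : (0 : ℝ) < n := by exact_mod_cast hn
      rw [Real.rpow_sub_one hn'.ne']
      field_simp

lemma isBigO_inv_Gamma_of_re_pos {s : ℂ} (hs : 0 < s.re) :
    (fun n : ℕ => (Complex.Gamma (s + n))⁻¹) =O[atTop]
      fun n : ℕ => (n : ℝ) ^ (1 - s.re) * (n.factorial : ℝ)⁻¹ := by
  have hs' : ∀ m : ℕ, s + m ≠ 0 := fun m h => by
    have := congrArg Complex.re h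
    simp at this
    linarith [Nat.cast_nonneg (α := ℝ) m]
  have hG := Complex.Gamma_ne_zero_of_re_pos hs
  have h1 := (Complex.GammaSeq_tendsto_Gamma s).isBigO_one ℝ
  have h2 : (fun n : ℕ => ((n : ℂ) ^ s * (n.factorial : ℂ))⁻¹) =O[atTop]
      fun n : ℕ => ((n : ℝ) ^ s.re * (n.factorial : ℝ))⁻¹ := by
    refine IsBigO.of_bound 1 ?_
    filter_upwards [eventually_ge_atTop 1] with n hn
    rw [norm_inv, norm_mul, norm_natCast_cpow n hn, Complex.norm_natCast, one_mul]
    exact le_abs_self _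
  refine ((((h1.mul h2).mul (isBigO_natCast_add s))).const_mul_left
    (Complex.Gamma s)⁻¹).congr' ?_ ?_
  · filter_upwards [eventually_ge_atTop 1] with n hn
    have hn' : (n : ℂ) ≠ 0 := by exact_mod_cast (Nat.one_le_iff_ne_zero.1 hn)
    have h3 : (n : ℂ) ^ s ≠ 0 := by simp [Complex.cpow_eq_zero_iff, hn']
    have h4 := factorial_cast_ne_zero n
    have h5 := hs' n
    have h6 : pochhammer s n ≠ 0 := by
      intro h
      have := inv_Gamma_eq_pochhammer_mul s n
      rw [h, zero_mul, inv_eq_zero] at this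
      exact hG this
    rw [GammaSeq_eq_pochhammer, pochhammer_succ, inv_Gamma_eq_pochhammer_mul s n]
    field_simp
  · filter_upwards [eventually_ge_atTop 1] with n hn
    have hn' : (0 : ℝ) < n := by exact_mod_cast hn
    rw [Real.rpow_sub hn', Real.rpow_one]
    field_simp

/-- The recurrence `1/Γ(s+n) = (s+n)/Γ(s+1+n)` costs one power of `n`, which moves the bound one
unit to the left from the half-plane `Re s > 0`. -/
lemma isBigO_inv_Gamma (s : ℂ) :
    (fun n : ℕ => (Complex.Gamma (s + n))⁻¹) =O[atTop]
      fun n : ℕ => (n : ℝ) ^ (1 - s.re) * (n.factorial : ℝ)⁻¹ := by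
  have key : ∀ (m : ℕ) (s : ℂ), 0 < s.re + m →
      (fun n : ℕ => (Complex.Gamma (s + n))⁻¹) =O[atTop]
        fun n : ℕ => (n : ℝ) ^ (1 - s.re) * (n.factorial : ℝ)⁻¹ := by
    intro m
    induction m with
    | zero => exact fun s hs => isBigO_inv_Gamma_of_re_pos (by simpa using hs)
    | succ m ih =>
      intro s hs
      have h1 := ih (s + 1) (by push_cast at hs; simp; linarith)
      refine ((isBigO_natCast_add s).mul h1).congr' ?_ ?_
      · refine Eventually.of_forall fun n => ?_
        beta_reduce
        rw [Complex.one_div_Gamma_eq_self_mul_one_div_Gamma_add_one (s + n), add_right_comm]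
      · filter_upwards [eventually_ge_atTop 1] with n hn
        have hn' : (0 : ℝ) < n := by exact_mod_cast hn
        rw [show 1 - s.re = 1 - (s + 1).re + 1 by simp only [Complex.add_re, Complex.one_re]; ring,
           Real.rpow_add_one hn'.ne']
        ring
  obtain ⟨m, hm⟩ := exists_nat_gt (-s.re)
  exact key m s (by linarith)

/-- The growth of the ratio `(a)ₙ / Γ(c + n)`. -/
lemma isBigO_pochhammer_div_Gamma (a c : ℂ) :
    (fun n : ℕ => pochhammer a n * (Complex.Gamma (c + n))⁻¹) =O[atTop]
      fun n : ℕ => (n : ℝ) ^ (a.re - c.re) := by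
  refine ((isBigO_pochhammer a).mul (isBigO_inv_Gamma c)).congr' EventuallyEq.rfl ?_
  filter_upwards [eventually_ge_atTop 1] with n hn
  have hn' : (0 : ℝ) < n := by exact_mod_cast hn
  have h : (n.factorial : ℝ) ≠ 0 := Nat.cast_ne_zero.2 n.factorial_ne_zero
  rw [show a.re - c.re = (a.re - 1) + (1 - c.re) by ring, Real.rpow_add hn']
  field_simp

/-- The growth of the ratio `(a)ₙ / n!`. -/
lemma isBigO_pochhammer_div_factorial (a : ℂ) :
    (fun n : ℕ => pochhammer a n / (n.factorial : ℂ)) =O[atTop]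
      fun n : ℕ => (n : ℝ) ^ (a.re - 1) := by
  simpa [add_comm (1 : ℂ), Complex.Gamma_nat_eq_factorial, div_eq_mul_inv] using
    isBigO_pochhammer_div_Gamma a 1

lemma summable_rpow_mul_pow (p : ℝ) {w : ℝ} (hw0 : 0 ≤ w) (hw1 : w < 1) :
    Summable fun n : ℕ => (n : ℝ) ^ p * w ^ n := by
  obtain ⟨k, hk⟩ := exists_nat_ge p
  refine summable_of_isBigO_nat (summable_pow_mul_geometric_of_norm_lt_one k
    (r := w) (by rwa [Real.norm_of_nonneg hw0])) ?_
  refine IsBigO.of_bound 1 ?_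
  filter_upwards [eventually_ge_atTop 1] with n hn
  have h1 : (1 : ℝ) ≤ n := by exact_mod_cast hn
  rw [one_mul, norm_mul, norm_mul]
  gcongr
  rw [Real.norm_of_nonneg (by positivity), Real.norm_of_nonneg (by positivity), ← Real.rpow_natCast]
  exact Real.rpow_le_rpow_of_exponent_le h1 hk

/-! ### The regularized hypergeometric series and Euler's transformation -/

/-- The coefficients of the power series `regularizedHypergeometric`. -/
noncomputable def hypergeometricCoeff (a b c : ℂ) (k : ℕ) : ℂ :=
  pochhammer a k * pochhammer b k / (Complex.Gamma (c + k) * (k.factorial : ℂ))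

lemma hypergeometricCoeff_eq (a b c : ℂ) (k : ℕ) :
    hypergeometricCoeff a b c k =
      pochhammer a k * (Complex.Gamma (c + k))⁻¹ * (pochhammer b k / (k.factorial : ℂ)) := by
  rw [hypergeometricCoeff, div_eq_mul_inv, mul_inv]; ring

lemma regularizedHypergeometric_eq_tsum (a b c z : ℂ) :
    regularizedHypergeometric a b c z = ∑' k : ℕ, hypergeometricCoeff a b c k * z ^ k := rfl

lemma isBigO_hypergeometricCoeff (a b c : ℂ) :
    hypergeometricCoeff a b c =O[atTop] fun n : ℕ => (n : ℝ) ^ (a.re - c.re + (b.re - 1)) := by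
  refine ((isBigO_pochhammer_div_Gamma a c).mul (isBigO_pochhammer_div_factorial b)).congr' ?_ ?_
  · exact Eventually.of_forall fun k => (hypergeometricCoeff_eq a b c k).symm
  · filter_upwards [eventually_ge_atTop 1] with n hn
    have hn' : (0 : ℝ) < n := by exact_mod_cast hn
    rw [← Real.rpow_add hn']

lemma summable_norm_mul_pow_of_isBigO {f : ℕ → ℂ} {p : ℝ}
    (hf : f =O[atTop] fun n : ℕ => (n : ℝ) ^ p) {r : ℝ} (hr0 : 0 ≤ r) (hr1 : r < 1) :
    Summable fun k : ℕ => ‖f k‖ * r ^ k :=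
  summable_of_isBigO_nat (summable_rpow_mul_pow p hr0 hr1)
    (hf.norm_left.mul (isBigO_refl (fun n : ℕ => r ^ n) atTop))

lemma summable_norm_hypergeometricCoeff (a b c : ℂ) {r : ℝ} (hr0 : 0 ≤ r) (hr1 : r < 1) :
    Summable fun k : ℕ => ‖hypergeometricCoeff a b c k‖ * r ^ k :=
  summable_norm_mul_pow_of_isBigO (isBigO_hypergeometricCoeff a b c) hr0 hr1

lemma summable_hypergeometricCoeff (a b c : ℂ) {z : ℂ} (hz : ‖z‖ < 1) :
    Summable fun k : ℕ => hypergeometricCoeff a b c k * z ^ k := by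
  refine Summable.of_norm ?_
  simpa using summable_norm_hypergeometricCoeff a b c (norm_nonneg z) hz

lemma differentiableOn_regularizedHypergeometric (a b c : ℂ) :
    DifferentiableOn ℂ (regularizedHypergeometric a b c) (Metric.ball 0 1) := by
  intro z hz
  obtain ⟨r, hzr, hr1⟩ := exists_between (mem_ball_zero_iff.1 hz)
  have h : DifferentiableOn ℂ (fun z => ∑' k : ℕ, hypergeometricCoeff a b c k * z ^ k)
      (Metric.ball 0 r) := by
    refine Complex.differentiableOn_tsum_of_summable_norm
      (summable_norm_hypergeometricCoeff a b c ((norm_nonneg z).trans hzr.le) hr1)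
      (fun k => (by fun_prop)) Metric.isOpen_ball fun k w hw => ?_
    rw [norm_mul, norm_pow]
    gcongr
    exact (mem_ball_zero_iff.1 hw).le
  exact (h.differentiableAt (Metric.isOpen_ball.mem_nhds
    (mem_ball_zero_iff.2 hzr))).differentiableWithinAt

lemma norm_regularizedHypergeometric_le (a b c : ℂ) {r : ℝ} (hr1 : r < 1) {z : ℂ}
    (hz : ‖z‖ ≤ r) :
    ‖regularizedHypergeometric a b c z‖ ≤ ∑' k : ℕ, ‖hypergeometricCoeff a b c k‖ * r ^ k := by
  have hs := summable_norm_hypergeometricCoeff a b c ((norm_nonneg z).trans hz) hr1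
  refine tsum_of_norm_bounded hs.hasSum fun k => ?_
  have : ‖hypergeometricCoeff a b c k * z ^ k‖ ≤ ‖hypergeometricCoeff a b c k‖ * r ^ k := by
    rw [norm_mul, norm_pow]; gcongr
  exact this

lemma Ring_choose_eq_pochhammer (a : ℂ) (n : ℕ) :
    Ring.choose (a + n - 1) n = pochhammer a n / (n.factorial : ℂ) := by
  rw [Ring.choose_eq_smul, Polynomial.descPochhammer_smeval_eq_ascPochhammer,
    Polynomial.ascPochhammer_smeval_cast, Polynomial.ascPochhammer_smeval_eq_eval, pochhammer,
    show a + n - 1 - n + 1 = a by ring]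
  rw [div_eq_inv_mul]; simp

lemma hasSum_one_sub_cpow (a : ℂ) {z : ℂ} (hz : ‖z‖ < 1) :
    HasSum (fun n : ℕ => pochhammer a n / (n.factorial : ℂ) * z ^ n) ((1 - z) ^ (-a)) := by
  have h := (Complex.one_div_one_sub_cpow_hasFPowerSeriesOnBall_zero a).hasSum
    (y := z) (by rw [← ENNReal.ofReal_one, Metric.eball_ofReal]; simpa using hz)
  rw [zero_add, one_div, ← Complex.cpow_neg] at h
  refine h.congr_fun fun n => ?_
  rw [FormalMultilinearSeries.ofScalars_apply_eq, Ring_choose_eq_pochhammer, smul_eq_mul]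

lemma summable_norm_pochhammer_div_factorial (a : ℂ) {r : ℝ} (hr0 : 0 ≤ r) (hr1 : r < 1) :
    Summable fun n : ℕ => ‖pochhammer a n / (n.factorial : ℂ)‖ * r ^ n :=
  summable_norm_mul_pow_of_isBigO (isBigO_pochhammer_div_factorial a) hr0 hr1

/-- Euler's transformation. -/
theorem regularizedHypergeometric_euler (a b c : ℂ) {z : ℂ} (hz : ‖z‖ < 1) :
    regularizedHypergeometric a b c z =
      (1 - z) ^ (c - a - b) * regularizedHypergeometric (c - a) (c - b) c z := by
  have hb := hasSum_one_sub_cpow (a + b - c) hz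
  rw [neg_sub, show c - (a + b) = c - a - b by ring] at hb
  rw [← hb.tsum_eq, regularizedHypergeometric_eq_tsum, regularizedHypergeometric_eq_tsum]
  have h1 : Summable fun n : ℕ =>
      ‖pochhammer (a + b - c) n / (n.factorial : ℂ) * z ^ n‖ := by
    simpa only [norm_mul, norm_pow] using
      summable_norm_pochhammer_div_factorial (a + b - c) (norm_nonneg z) hz
  have h2 : Summable fun n : ℕ => ‖hypergeometricCoeff (c - a) (c - b) c n * z ^ n‖ := by
    simpa only [norm_mul, norm_pow] using
      summable_norm_hypergeometricCoeff (c - a) (c - b) c (norm_nonneg z) hz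
  rw [tsum_mul_tsum_eq_tsum_sum_antidiagonal_of_summable_norm h1 h2]
  refine tsum_congr fun N => ?_
  rw [← Nat.sum_antidiagonal_swap]
  simp only [Prod.fst_swap, Prod.snd_swap]
  rw [Nat.sum_antidiagonal_eq_sum_range_succ (fun k j : ℕ =>
    pochhammer (a + b - c) j / (j.factorial : ℂ) * z ^ j *
      (hypergeometricCoeff (c - a) (c - b) c k * z ^ k)) N]
  -- The coefficients of the Cauchy product form a Saalschütz sum once each `1/Γ(c+k)` is written as
  -- `(c+k)_{N-k}/Γ(c+N)`.
  rw [hypergeometricCoeff, mul_comm (Complex.Gamma (c + N)), ← div_div,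
    ← sum_pochhammer_saalschutz a b c N, div_mul_eq_mul_div, sum_mul, sum_div]
  refine sum_congr rfl fun k hk => ?_
  obtain ⟨d, rfl⟩ := Nat.exists_eq_add_of_le (Nat.lt_succ_iff.1 (mem_range.1 hk))
  have hG := inv_Gamma_eq_pochhammer_mul (c + k) d
  rw [add_tsub_cancel_left, hypergeometricCoeff_eq, hG, div_eq_mul_inv _ (Complex.Gamma _)]
  push_cast
  rw [add_assoc c, pow_add]
  ring

/-! ### Majorants for the series -/

/-- A bound on the disc of radius `r` for the hypergeometric function in `P_{ν+n}^{-μ-n}`. -/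
noncomputable def legendreMajorant (ν μ : ℂ) (r : ℝ) (n : ℕ) : ℝ :=
  ∑' k : ℕ, ‖hypergeometricCoeff (-ν - n) (μ - ν) (1 + μ + n) k‖ * r ^ k

lemma norm_pochhammer_le_of_norm_add_le {s t : ℂ} {q : ℝ} (hq : 0 ≤ q)
    (h : ∀ j : ℕ, ‖s + j‖ ≤ q * ‖t + j‖) (k : ℕ) :
    ‖pochhammer s k‖ ≤ q ^ k * ‖pochhammer t k‖ := by
  induction k with
  | zero => simp
  | succ k ih =>
    rw [pochhammer_succ, pochhammer_succ, norm_mul, norm_mul, pow_succ]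
    calc _ ≤ (q ^ k * ‖pochhammer t k‖) * (q * ‖t + k‖) :=
          mul_le_mul ih (h k) (norm_nonneg _) (by positivity)
      _ = _ := by ring

/-- For large `n`, `|(-ν-n)_k| ≤ q^k |(1+μ+n)_k|` with `q` slightly above `1`. The factor
`(1+μ+n)_k` turns `1/Γ(1+μ+n+k)` into `1/Γ(1+μ+n)`, and a convergent series independent of `n`
remains. -/
lemma isBigO_legendreMajorant (ν μ : ℂ) {r : ℝ} (hr0 : 0 ≤ r) (hr1 : r < 1) :
    legendreMajorant ν μ r =O[atTop] fun n : ℕ => (Complex.Gamma (1 + μ + n))⁻¹ := by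
  -- Any `q > 1` with `q * r < 1` would do.
  set q : ℝ := 2 / (1 + r) with hq
  have hq1 : 0 < q - 1 := by
    rw [hq, sub_pos, lt_div_iff₀ (by linarith)]; linarith
  have hqr0 : 0 ≤ q * r := mul_nonneg (by linarith) hr0
  have hqr1 : q * r < 1 := by
    rw [hq, div_mul_eq_mul_div, div_lt_one (by linarith)]; linarith
  have hs := summable_norm_pochhammer_div_factorial (μ - ν) hqr0 hqr1
  refine IsBigO.of_bound (∑' k : ℕ, ‖pochhammer (μ - ν) k / (k.factorial : ℂ)‖ * (q * r) ^ k) ?_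
  filter_upwards [eventually_ge_atTop ⌈(‖ν‖ + q * ‖μ‖) / (q - 1)⌉₊] with n hn
  have hn' : ‖ν‖ + q * ‖μ‖ ≤ n * (q - 1) := by
    rw [← div_le_iff₀ hq1]
    exact (Nat.le_ceil _).trans (by exact_mod_cast hn)
  have hp : ∀ j : ℕ, ‖-ν - n + j‖ ≤ q * ‖1 + μ + n + j‖ := by
    intro j
    have e1 : ‖-ν - n + j‖ ≤ ‖ν‖ + n + j := by
      refine (norm_add_le _ _).trans ?_
      refine add_le_add ((norm_sub_le _ _).trans ?_) (by simp)
      simp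
    have e2 : (n : ℝ) + j + 1 - ‖μ‖ ≤ ‖1 + μ + n + j‖ := by
      have := norm_sub_le (1 + μ + n + j) μ
      rw [show 1 + μ + n + j - μ = ((n + j + 1 : ℕ) : ℂ) by push_cast; ring,
        Complex.norm_natCast] at this
      push_cast at this
      linarith
    have e3 : 0 ≤ (q - 1) * (j : ℝ) := by positivity
    calc _ ≤ ‖ν‖ + n + j := e1
      _ ≤ q * (n + j + 1 - ‖μ‖) := by nlinarith
      _ ≤ _ := mul_le_mul_of_nonneg_left e2 (by linarith)
  have hk : ∀ k : ℕ, ‖hypergeometricCoeff (-ν - n) (μ - ν) (1 + μ + n) k‖ * r ^ k ≤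
      ‖pochhammer (μ - ν) k / (k.factorial : ℂ)‖ * (q * r) ^ k *
        ‖(Complex.Gamma (1 + μ + n))⁻¹‖ := by
    intro k
    rw [hypergeometricCoeff_eq, inv_Gamma_eq_pochhammer_mul (1 + μ + n) k, norm_mul, norm_mul,
      norm_mul (pochhammer (1 + μ + n) k), mul_pow]
    have := norm_pochhammer_le_of_norm_add_le (by linarith) hp k
    calc _ ≤ q ^ k * ‖pochhammer (1 + μ + n) k‖ * ‖(Complex.Gamma (1 + μ + n + k))⁻¹‖ *
          ‖pochhammer (μ - ν) k / (k.factorial : ℂ)‖ * r ^ k := by gcongr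
      _ = _ := by ring
  have hnn : 0 ≤ legendreMajorant ν μ r n := tsum_nonneg fun k => by positivity
  rw [Real.norm_of_nonneg hnn, ← tsum_mul_right]
  exact (summable_norm_hypergeometricCoeff _ _ _ hr0 hr1).tsum_le_tsum hk (hs.mul_right _)

/-- The coefficient `((μ+ν+1)/2)ₙ (ν+1)ₙ / n!`. -/
noncomputable def legendreWeight (ν μ : ℂ) (n : ℕ) : ℂ :=
  pochhammer ((μ + ν + 1) / 2) n * pochhammer (ν + 1) n / (n.factorial : ℂ)

lemma isBigO_legendreWeight_mul_majorant (ν μ : ℂ) {r : ℝ} (hr0 : 0 ≤ r) (hr1 : r < 1) :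
    (fun n : ℕ => ‖legendreWeight ν μ n‖ * legendreMajorant ν μ r n) =O[atTop]
      fun n : ℕ => (n : ℝ) ^ (((3 * ν - μ).re - 1) / 2) := by
  have h1 : (fun n : ℕ => ‖legendreWeight ν μ n‖ * legendreMajorant ν μ r n) =O[atTop]
      fun n : ℕ => legendreWeight ν μ n * (Complex.Gamma (1 + μ + n))⁻¹ :=
    (isBigO_refl (legendreWeight ν μ) atTop).norm_left.mul (isBigO_legendreMajorant ν μ hr0 hr1)
  refine h1.trans ?_
  refine ((isBigO_pochhammer_div_factorial ((μ + ν + 1) / 2)).mul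
    (isBigO_pochhammer_div_Gamma (ν + 1) (1 + μ))).congr' ?_ ?_
  · exact Eventually.of_forall fun n => by simp only [legendreWeight]; ring
  · filter_upwards [eventually_ge_atTop 1] with n hn
    have hn' : (0 : ℝ) < n := by exact_mod_cast hn
    rw [← Real.rpow_add hn']
    congr 1
    have : ((μ + ν + 1) / 2).re = (μ.re + ν.re + 1) / 2 := by simp
    rw [this]
    simp
    ring

lemma summable_legendreWeight_mul_majorant (ν μ : ℂ) {r w : ℝ} (hr0 : 0 ≤ r) (hr1 : r < 1)
    (hw0 : 0 ≤ w) (hw1 : w < 1) :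
    Summable fun n : ℕ => ‖legendreWeight ν μ n‖ * legendreMajorant ν μ r n * w ^ n :=
  summable_of_isBigO_nat (summable_rpow_mul_pow _ hw0 hw1)
    ((isBigO_legendreWeight_mul_majorant ν μ hr0 hr1).mul
      (isBigO_refl (fun n : ℕ => w ^ n) atTop))

lemma summable_legendreWeight_mul_majorant_one {ν μ : ℂ} (h : (3 * ν - μ).re < -1) {r : ℝ}
    (hr0 : 0 ≤ r) (hr1 : r < 1) :
    Summable fun n : ℕ => ‖legendreWeight ν μ n‖ * legendreMajorant ν μ r n * 1 ^ n := by
  simp only [one_pow, mul_one]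
  exact summable_of_isBigO_nat (Real.summable_nat_rpow.2 (by linarith))
    (isBigO_legendreWeight_mul_majorant ν μ hr0 hr1)

lemma pochhammer_neg_natCast_of_lt {k n : ℕ} (h : k < n) : pochhammer (-k) n = 0 :=
  ascPochhammer_eval_neg_coe_nat_of_lt h

lemma summable_legendreWeight_mul_majorant_of_terminating {ν μ : ℂ}
    (h : (∃ k : ℕ, 1 ≤ k ∧ -ν = k) ∨ ∃ k : ℕ, -((μ + ν + 1) / 2) = k) (r w : ℝ) :
    Summable fun n : ℕ => ‖legendreWeight ν μ n‖ * legendreMajorant ν μ r n * w ^ n := by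
  have : ∃ m : ℕ, ∀ n, m < n → legendreWeight ν μ n = 0 := by
    rcases h with ⟨k, hk1, hk⟩ | ⟨k, hk⟩
    · refine ⟨k - 1, fun n hn => ?_⟩
      have : ν + 1 = -((k - 1 : ℕ) : ℂ) := by rw [Nat.cast_sub hk1, ← hk]; push_cast; ring
      rw [legendreWeight, this, pochhammer_neg_natCast_of_lt hn]
      simp
    · refine ⟨k, fun n hn => ?_⟩
      rw [legendreWeight, show (μ + ν + 1) / 2 = -(k : ℂ) by rw [← hk]; ring,
        pochhammer_neg_natCast_of_lt hn]
      simp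
  obtain ⟨m, hm⟩ := this
  refine summable_of_ne_finset_zero (s := range (m + 1)) fun n hn => ?_
  rw [hm n (by simpa using hn)]
  simp

/-! ### The expansion near the origin -/

lemma exists_norm_le_mul_two_pow {f : ℕ → ℂ} {p : ℝ}
    (hf : f =O[atTop] fun n : ℕ => (n : ℝ) ^ p) : ∃ C : ℝ, 0 ≤ C ∧ ∀ n, ‖f n‖ ≤ C * 2 ^ n := by
  have hs := summable_norm_mul_pow_of_isBigO hf (r := 1 / 2) (by norm_num) (by norm_num)
  refine ⟨∑' n, ‖f n‖ * (1 / 2) ^ n, tsum_nonneg fun n => by positivity, fun n => ?_⟩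
  have h := hs.le_tsum n fun m _ => by positivity
  calc ‖f n‖ = ‖f n‖ * (1 / 2) ^ n * 2 ^ n := by
        rw [mul_assoc, ← mul_pow]; norm_num
    _ ≤ _ := by gcongr

/-- With `M ≥ |A|` the quotient is at most the binomial coefficient `(M+2n+k choose k) ≤
2^(M+2n+k)`; uniformity in `n` and `k` is what the double series needs. -/
lemma exists_norm_pochhammer_add_two_mul_le (A : ℂ) :
    ∃ C : ℝ, 0 ≤ C ∧ ∀ n k : ℕ,
      ‖pochhammer (A + 2 * n) k / (k.factorial : ℂ)‖ ≤ C * 2 ^ (2 * n + k) := by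
  obtain ⟨M, hM⟩ := exists_nat_ge ‖A‖
  refine ⟨2 ^ M, by positivity, fun n k => ?_⟩
  have h := norm_pochhammer_le_of_norm_add_le (s := A + 2 * n) (t := ((M + 2 * n + 1 : ℕ) : ℂ))
    (q := 1) zero_le_one (fun j => ?_) k
  · have h2 : pochhammer ((M + 2 * n + 1 : ℕ) : ℂ) k =
        (k.factorial : ℂ) * ((M + 2 * n + k).choose k : ℂ) := by
      rw [pochhammer, ascPochhammer_nat_eq_natCast_ascFactorial,
        Nat.ascFactorial_eq_factorial_mul_choose]
      push_cast
      rfl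
    rw [h2, one_pow, one_mul, norm_mul, Complex.norm_natCast, Complex.norm_natCast] at h
    rw [norm_div, Complex.norm_natCast, div_le_iff₀ (by positivity)]
    refine h.trans ?_
    rw [mul_comm]
    gcongr
    rw [← pow_add, ← add_assoc]
    exact_mod_cast Nat.choose_le_two_pow _ _
  · rw [one_mul, ← Nat.cast_add, Complex.norm_natCast, add_assoc]
    refine (norm_add_le _ _).trans ?_
    rw [show (2 * (n : ℂ) + j) = ((2 * n + j : ℕ) : ℂ) by push_cast; rfl, Complex.norm_natCast]
    push_cast
    linarith

/-- The terms of the double series obtained by expanding every hypergeometric function in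
`hasSum_regularizedHypergeometric_of_norm_lt`. -/
noncomputable def legendreDoubleTerm (ν μ z : ℂ) (p : ℕ × ℕ) : ℂ :=
  legendreWeight ν μ p.1 * (4 * z) ^ p.1 *
    (hypergeometricCoeff (μ + ν + 1 + 2 * p.1) (ν + 1 + p.1) (1 + μ + p.1) p.2 * (-z) ^ p.2)

lemma legendreDoubleTerm_eq (ν μ z : ℂ) (n k : ℕ) :
    legendreDoubleTerm ν μ z (n, k) =
      pochhammer (ν + 1) (n + k) * (Complex.Gamma (1 + μ + (n + k : ℕ)))⁻¹ *
        (pochhammer ((μ + ν + 1) / 2) n * 4 ^ n / (n.factorial : ℂ) *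
          (pochhammer (μ + ν + 1 + 2 * n) k * (-1) ^ k / (k.factorial : ℂ))) * z ^ (n + k) := by
  rw [legendreDoubleTerm, hypergeometricCoeff, legendreWeight, pochhammer_add, neg_pow z k,
    mul_pow, pow_add]
  push_cast
  rw [add_assoc (1 + μ)]
  field_simp

/-- Crude exponential bounds give the geometric majorant `(64|z|)ⁿ (4|z|)ᵏ`, whence the radius
`1/64`. Any neighbourhood of `0` suffices for the continuation. -/
lemma summable_legendreDoubleTerm (ν μ : ℂ) {z : ℂ} (hz : ‖z‖ < 1 / 64) :
    Summable (legendreDoubleTerm ν μ z) := by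
  obtain ⟨C₁, hC₁, h₁⟩ := exists_norm_le_mul_two_pow
    (isBigO_pochhammer_div_factorial ((μ + ν + 1) / 2))
  obtain ⟨C₂, hC₂, h₂⟩ := exists_norm_pochhammer_add_two_mul_le (μ + ν + 1)
  obtain ⟨C₃, hC₃, h₃⟩ := exists_norm_le_mul_two_pow
    (isBigO_pochhammer_div_Gamma (ν + 1) (1 + μ))
  have hg : Summable fun p : ℕ × ℕ => (64 * ‖z‖) ^ p.1 * (4 * ‖z‖) ^ p.2 :=
    (summable_geometric_of_lt_one (by positivity) (by linarith)).mul_of_nonneg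
      (summable_geometric_of_lt_one (by positivity) (by linarith))
      (fun _ => by positivity) (fun _ => by positivity)
  refine Summable.of_norm_bounded (hg.mul_left (C₁ * C₂ * C₃)) ?_
  rintro ⟨n, k⟩
  rw [legendreDoubleTerm_eq]
  calc _ = ‖pochhammer (ν + 1) (n + k) * (Complex.Gamma (1 + μ + (n + k : ℕ)))⁻¹‖ *
        (‖pochhammer ((μ + ν + 1) / 2) n / (n.factorial : ℂ)‖ * 4 ^ n *
          ‖pochhammer (μ + ν + 1 + 2 * n) k / (k.factorial : ℂ)‖) * ‖z‖ ^ (n + k) := by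
        simp only [norm_mul, norm_div, norm_pow, norm_neg, norm_one, one_pow]
        rw [show ‖(4 : ℂ)‖ = 4 by simp]
        ring
    _ ≤ C₃ * 2 ^ (n + k) * (C₁ * 2 ^ n * 4 ^ n * (C₂ * 2 ^ (2 * n + k))) * ‖z‖ ^ (n + k) := by
        gcongr
        · exact h₃ _
        · exact h₁ _
        · exact h₂ _ _
    _ = _ := by
        have e1 : (64 : ℝ) ^ n = (2 ^ n) ^ 4 * 4 ^ n := by
          rw [← pow_mul, mul_comm n, pow_mul, ← mul_pow]; norm_num
        have e2 : (4 : ℝ) ^ k = (2 ^ k) ^ 2 := by rw [← pow_mul, mul_comm k, pow_mul]; norm_num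
        rw [mul_pow, mul_pow, e1, e2]
        ring

lemma sum_antidiagonal_legendreDoubleTerm (ν μ z : ℂ) (N : ℕ) :
    ∑ p ∈ antidiagonal N, legendreDoubleTerm ν μ z p =
      hypergeometricCoeff (μ + ν + 1) (ν + 1) (1 + μ) N * z ^ N := by
  have h : hypergeometricCoeff (μ + ν + 1) (ν + 1) (1 + μ) N =
      pochhammer (ν + 1) N * (Complex.Gamma (1 + μ + N))⁻¹ *
        (pochhammer (μ + ν + 1) N / (N.factorial : ℂ)) := by
    rw [hypergeometricCoeff_eq]; ring
  rw [Nat.sum_antidiagonal_eq_sum_range_succ_mk, h, ← sum_pochhammer_quadratic, mul_sum, sum_mul]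
  refine sum_congr rfl fun n hn => ?_
  rw [legendreDoubleTerm_eq, Nat.add_sub_cancel' (Nat.lt_succ_iff.1 (mem_range.1 hn))]

lemma hasSum_sum_antidiagonal_of_hasSum {f : ℕ × ℕ → ℂ} {S : ℂ} (hf : HasSum f S) :
    HasSum (fun N => ∑ p ∈ antidiagonal N, f p) S := by
  have h1 := (HasAntidiagonal.sigmaAntidiagonalEquivProd (A := ℕ)).hasSum_iff.2 hf
  refine (h1.sigma fun N => hasSum_fintype _).congr_fun fun N => ?_
  exact (sum_coe_sort (antidiagonal N) f).symm

theorem hasSum_regularizedHypergeometric_of_norm_lt (ν μ : ℂ) {z : ℂ} (hz : ‖z‖ < 1 / 64) :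
    HasSum (fun n : ℕ => legendreWeight ν μ n * (4 * z) ^ n *
        regularizedHypergeometric (μ + ν + 1 + 2 * n) (ν + 1 + n) (1 + μ + n) (-z))
      (regularizedHypergeometric (μ + ν + 1) (ν + 1) (1 + μ) z) := by
  have hf := (summable_legendreDoubleTerm ν μ hz).hasSum
  have h3 : ∑' p, legendreDoubleTerm ν μ z p =
      regularizedHypergeometric (μ + ν + 1) (ν + 1) (1 + μ) z := by
    rw [← (hasSum_sum_antidiagonal_of_hasSum hf).tsum_eq, regularizedHypergeometric_eq_tsum]
    exact tsum_congr fun N => sum_antidiagonal_legendreDoubleTerm ν μ z N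
  rw [h3] at hf
  refine hf.prod_fiberwise fun n => ?_
  have hz' : ‖-z‖ < 1 := by rw [norm_neg]; linarith
  exact (summable_hypergeometricCoeff (μ + ν + 1 + 2 * n) (ν + 1 + n) (1 + μ + n)
    hz').hasSum.mul_left (legendreWeight ν μ n * (4 * z) ^ n)

/-! ### Terms and sum as analytic functions on the unit disc -/

lemma one_add_mem_slitPlane {z : ℂ} (hz : ‖z‖ < 1) : 1 + z ∈ Complex.slitPlane :=
  Complex.mem_slitPlane_of_norm_lt_one hz

/-- The terms of the series of `P_{ν+n}^{-μ-n}`, in terms of the variable `z = ± (1-x)/(1+x)`. -/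
noncomputable def legendreTerm (ν μ : ℂ) (n : ℕ) (z : ℂ) : ℂ :=
  legendreWeight ν μ n * (4 * z / (1 + z) ^ 2) ^ n *
    regularizedHypergeometric (-ν - n) (μ - ν) (1 + μ + n) (-z)

lemma norm_legendreTerm_le (ν μ : ℂ) (n : ℕ) {z : ℂ} {r w : ℝ} (hr : r < 1) (hzr : ‖z‖ ≤ r)
    (hw : 4 * ‖z‖ ≤ w * ‖1 + z‖ ^ 2) :
    ‖legendreTerm ν μ n z‖ ≤ ‖legendreWeight ν μ n‖ * legendreMajorant ν μ r n * w ^ n := by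
  have h1 : 0 < ‖1 + z‖ :=
    norm_pos_iff.2 (Complex.slitPlane_ne_zero (one_add_mem_slitPlane (hzr.trans_lt hr)))
  have h2 : ‖4 * z / (1 + z) ^ 2‖ ≤ w := by
    rw [norm_div, norm_mul, norm_pow, div_le_iff₀ (by positivity)]
    simpa using hw
  have h3 := norm_regularizedHypergeometric_le (-ν - n) (μ - ν) (1 + μ + n) hr
    (z := -z) (by rwa [norm_neg])
  have hw0 : 0 ≤ w := (norm_nonneg _).trans h2
  rw [legendreTerm, norm_mul, norm_mul, norm_pow]
  calc _ ≤ ‖legendreWeight ν μ n‖ * w ^ n * legendreMajorant ν μ r n := by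
        gcongr
        exact h3
    _ = _ := by ring

lemma differentiableOn_legendreTerm (ν μ : ℂ) (n : ℕ) :
    DifferentiableOn ℂ (legendreTerm ν μ n) (Metric.ball 0 1) := by
  have h1 : DifferentiableOn ℂ (fun z : ℂ => 4 * z / (1 + z) ^ 2) (Metric.ball 0 1) := by
    refine DifferentiableOn.div (by fun_prop) (by fun_prop) fun z hz => pow_ne_zero _ ?_
    exact Complex.slitPlane_ne_zero (one_add_mem_slitPlane (mem_ball_zero_iff.1 hz))
  refine ((h1.pow n).const_mul _).mul ?_
  refine (differentiableOn_regularizedHypergeometric _ _ _).comp (by fun_prop) fun z hz => ?_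
  simpa using hz

/-- The sum of the series `∑ₙ legendreTerm ν μ n z`. -/
noncomputable def legendreSum (ν μ z : ℂ) : ℂ :=
  (1 + z) ^ (2 * ν + 1) * regularizedHypergeometric (μ + ν + 1) (ν + 1) (1 + μ) z

lemma differentiableOn_legendreSum (ν μ : ℂ) :
    DifferentiableOn ℂ (legendreSum ν μ) (Metric.ball 0 1) := by
  refine DifferentiableOn.mul ?_ (differentiableOn_regularizedHypergeometric _ _ _)
  exact DifferentiableOn.cpow (by fun_prop) (by fun_prop)
    fun z hz => one_add_mem_slitPlane (mem_ball_zero_iff.1 hz)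

/-- Euler's transformation produces the power `-(2ν+1) - 2n` of `1+z`: its `n`-dependent part is the
denominator `(1+z)^(2n)`, and the rest is common to all terms. -/
lemma legendreTerm_eq (ν μ : ℂ) (n : ℕ) {z : ℂ} (hz : ‖z‖ < 1) :
    legendreTerm ν μ n z = (1 + z) ^ (2 * ν + 1) * (legendreWeight ν μ n * (4 * z) ^ n *
      regularizedHypergeometric (μ + ν + 1 + 2 * n) (ν + 1 + n) (1 + μ + n) (-z)) := by
  have h0 := Complex.slitPlane_ne_zero (one_add_mem_slitPlane hz)
  rw [legendreTerm, regularizedHypergeometric_euler (μ + ν + 1 + 2 * n) (ν + 1 + n) (1 + μ + n)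
    (z := -z) (by rwa [norm_neg]), sub_neg_eq_add,
    show 1 + μ + n - (μ + ν + 1 + 2 * n) = -ν - n by ring,
    show 1 + μ + n - (ν + 1 + n) = μ - ν by ring,
    show -ν - n - (ν + 1 + n) = -(2 * ν + 1) + -((2 * n : ℕ) : ℂ) by push_cast; ring,
    Complex.cpow_add (-(2 * ν + 1)) _ h0, Complex.cpow_neg, Complex.cpow_neg,
    Complex.cpow_natCast, div_pow, ← pow_mul]
  have h1 : (1 + z) ^ (2 * ν + 1) ≠ 0 := by simp [Complex.cpow_eq_zero_iff, h0]
  generalize (1 + z) ^ (2 * ν + 1) = c at *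
  field_simp

lemma legendreSum_eq (ν μ : ℂ) {z : ℂ} (hz : ‖z‖ < 1) :
    legendreSum ν μ z = (1 + z) ^ (2 * ν + 1) * (1 - z) ^ (-(2 * ν + 1)) *
      regularizedHypergeometric (-ν) (μ - ν) (1 + μ) z := by
  rw [legendreSum, regularizedHypergeometric_euler _ _ _ hz,
    show 1 + μ - (μ + ν + 1) = -ν by ring, show 1 + μ - (ν + 1) = μ - ν by ring,
    show -ν - (ν + 1) = -(2 * ν + 1) by ring, mul_assoc]

lemma hasSum_legendreTerm_of_norm_lt (ν μ : ℂ) {z : ℂ} (hz : ‖z‖ < 1 / 64) :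
    HasSum (fun n => legendreTerm ν μ n z) (legendreSum ν μ z) := by
  simp only [legendreTerm_eq ν μ _ (show ‖z‖ < 1 by linarith)]
  exact (hasSum_regularizedHypergeometric_of_norm_lt ν μ hz).mul_left _

/-! ### Analytic continuation -/

/-- The preimage of the disc of radius `w` under `z ↦ 4 z / (1 + z)²`, inside the disc of
radius `r`. -/
def koebeDomain (r w : ℝ) : Set ℂ := {z | ‖z‖ < r ∧ 4 * ‖z‖ < w * ‖1 + z‖ ^ 2}

lemma isOpen_koebeDomain (r w : ℝ) : IsOpen (koebeDomain r w) :=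
  IsOpen.and (isOpen_lt (by fun_prop) (by fun_prop)) (isOpen_lt (by fun_prop) (by fun_prop))

lemma koebeDomain_subset_ball {r w : ℝ} (hr : r ≤ 1) : koebeDomain r w ⊆ Metric.ball 0 1 :=
  fun _ hz => mem_ball_zero_iff.2 (hz.1.trans_le hr)

/-- The reason is `|1+sz|² - s|1+z|² = (1-s)(1-s|z|²) > 0`. Allowing equality in the hypothesis
gives both star-convexity and the approach to boundary points from inside. -/
lemma smul_mem_koebeDomain {r w s : ℝ} (hr : r ≤ 1) (hw : 0 < w) (hs0 : 0 ≤ s) (hs1 : s < 1)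
    {z : ℂ} (hz : ‖z‖ < r) (hzw : 4 * ‖z‖ ≤ w * ‖1 + z‖ ^ 2) : s • z ∈ koebeDomain r w := by
  have hn : ‖s • z‖ = s * ‖z‖ := by rw [norm_smul, Real.norm_of_nonneg hs0]
  refine ⟨?_, ?_⟩
  · rw [hn]; nlinarith [norm_nonneg z]
  · have h1 : ‖1 + z‖ ^ 2 = 1 + 2 * z.re + ‖z‖ ^ 2 := by
      rw [Complex.sq_norm, Complex.sq_norm, Complex.normSq_apply, Complex.normSq_apply]
      simp; ring
    have h2 : ‖1 + s • z‖ ^ 2 = 1 + 2 * (s * z.re) + s ^ 2 * ‖z‖ ^ 2 := by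
      rw [Complex.sq_norm, Complex.sq_norm, Complex.normSq_apply, Complex.normSq_apply]
      simp; ring
    have hz2 : ‖z‖ ^ 2 < 1 := by nlinarith [norm_nonneg z]
    have h3 : 0 < (1 - s) * (1 - s * ‖z‖ ^ 2) := by
      refine mul_pos (by linarith) ?_
      nlinarith [sq_nonneg ‖z‖]
    have h4 := mul_le_mul_of_nonneg_left hzw hs0
    rw [hn, h2]
    rw [h1] at h4
    nlinarith [mul_pos hw h3]

lemma isPreconnected_koebeDomain {r w : ℝ} (hr0 : 0 < r) (hr : r ≤ 1) (hw : 0 < w) :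
    IsPreconnected (koebeDomain r w) := by
  have h0 : (0 : ℂ) ∈ koebeDomain r w := ⟨by simpa using hr0, by simpa using hw⟩
  have hstar : StarConvex ℝ (0 : ℂ) (koebeDomain r w) := by
    rw [starConvex_zero_iff]
    intro z hz s hs0 hs1
    rcases hs1.lt_or_eq with h | rfl
    · exact smul_mem_koebeDomain hr hw hs0 h hz.1 hz.2.le
    · simpa using hz
  exact (hstar.isPathConnected h0).isConnected.isPreconnected

theorem hasSum_legendreTerm (ν μ : ℂ) {w : ℝ} (hw : 0 < w)
    (hsum : ∀ r : ℝ, 0 ≤ r → r < 1 →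
      Summable fun n : ℕ => ‖legendreWeight ν μ n‖ * legendreMajorant ν μ r n * w ^ n)
    {y : ℂ} (hy : ‖y‖ < 1) (hyw : 4 * ‖y‖ ≤ w * ‖1 + y‖ ^ 2) :
    HasSum (fun n => legendreTerm ν μ n y) (legendreSum ν μ y) := by
  obtain ⟨r, hyr, hr1⟩ := exists_between hy
  have hr0 : 0 < r := (norm_nonneg y).trans_lt hyr
  have hu := hsum r hr0.le hr1
  have hD : DifferentiableOn ℂ (fun z => ∑' n, legendreTerm ν μ n z) (koebeDomain r w) :=
    Complex.differentiableOn_tsum_of_summable_norm hu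
      (fun n => (differentiableOn_legendreTerm ν μ n).mono (koebeDomain_subset_ball hr1.le))
      (isOpen_koebeDomain r w) fun n z hz => norm_legendreTerm_le ν μ n hr1 hz.1.le hz.2.le
  have h0 : (0 : ℂ) ∈ koebeDomain r w := ⟨by simpa using hr0, by simpa using hw⟩
  have heq : Set.EqOn (fun z => ∑' n, legendreTerm ν μ n z) (legendreSum ν μ)
      (koebeDomain r w) := by
    refine (hD.analyticOnNhd (isOpen_koebeDomain r w)).eqOn_of_preconnected_of_eventuallyEq
      (((differentiableOn_legendreSum ν μ).mono (koebeDomain_subset_ball hr1.le)).analyticOnNhd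
        (isOpen_koebeDomain r w)) (isPreconnected_koebeDomain hr0 hr1.le hw) h0 ?_
    filter_upwards [Metric.ball_mem_nhds (0 : ℂ) (show (0 : ℝ) < 1 / 64 by norm_num)] with z hz
    exact (hasSum_legendreTerm_of_norm_lt ν μ (mem_ball_zero_iff.1 hz)).tsum_eq
  -- The point `y` may satisfy `4|y| = w|1+y|²`. The majorant still holds there, so the sum is
  -- continuous on `K` and the identity passes to the limit along rays `s • y`, `s → 1`.
  set K : Set ℂ := {z | ‖z‖ < r ∧ 4 * ‖z‖ ≤ w * ‖1 + z‖ ^ 2} with hK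
  have hKb : K ⊆ Metric.ball 0 1 := fun z hz => mem_ball_zero_iff.2 (hz.1.trans hr1)
  have hC : ContinuousOn (fun z => ∑' n, legendreTerm ν μ n z) K :=
    continuousOn_tsum (fun n => (differentiableOn_legendreTerm ν μ n).continuousOn.mono hKb) hu
      fun n z hz => norm_legendreTerm_le ν μ n hr1 hz.1.le hz.2
  have hcl : K ⊆ closure (koebeDomain r w) := by
    intro z hz
    have ht : Tendsto (fun s : ℝ => s • z) (𝓝[<] 1) (𝓝 z) := by
      have : Continuous fun s : ℝ => s • z := by fun_prop
      simpa using (this.tendsto 1).mono_left nhdsWithin_le_nhds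
    refine mem_closure_of_tendsto ht ?_
    filter_upwards [Ioo_mem_nhdsLT (show (0 : ℝ) < 1 by norm_num)] with s hs
    exact smul_mem_koebeDomain hr1.le hw hs.1.le hs.2 hz.1 hz.2
  have hEq := heq.of_subset_closure hC
    ((differentiableOn_legendreSum ν μ).continuousOn.mono hKb)
    (fun z hz => ⟨hz.1, hz.2.le⟩) hcl
  have hyK : y ∈ K := ⟨hyr, hyw⟩
  have hS : Summable fun n => legendreTerm ν μ n y :=
    Summable.of_norm_bounded hu fun n => norm_legendreTerm_le ν μ n hr1 hyr.le hyw
  have := hEq hyK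
  exact this ▸ hS.hasSum

/-! ### Return to the Legendre functions -/

/-- The elementary factor of `P_ν^{-μ}(x)` for `0 < x < 1`. -/
noncomputable def legendreFactor (ν μ : ℂ) (x : ℝ) : ℂ :=
  (2 : ℂ) ^ (-ν) * ((1 - x : ℝ) : ℂ) ^ (μ / 2) * ((1 + x : ℝ) : ℂ) ^ (ν - μ / 2)

lemma ofReal_cpow_add_nat_mul_half {a : ℝ} (ha : 0 < a) (s : ℂ) (n : ℕ) :
    (a : ℂ) ^ (s + n * (1 / 2)) = (a : ℂ) ^ s * (Real.sqrt a : ℂ) ^ n := by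
  have h : (a : ℂ) ^ (1 / 2 : ℂ) = (Real.sqrt a : ℂ) := by
    rw [Real.sqrt_eq_rpow, Complex.ofReal_cpow ha.le]; simp
  rw [Complex.cpow_add _ _ (by exact_mod_cast ha.ne'), Complex.cpow_nat_mul, h]

lemma legendreFactor_add_natCast (ν μ : ℂ) {x : ℝ} (hx0 : 0 < x) (hx1 : x < 1) (n : ℕ) :
    legendreFactor (ν + n) (μ + n) x =
      legendreFactor ν μ x * ((Real.sqrt (1 - x ^ 2) : ℂ) / 2) ^ n := by
  have h : (Real.sqrt (1 - x ^ 2) : ℂ) = Real.sqrt (1 - x) * Real.sqrt (1 + x) := by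
    rw [← Complex.ofReal_mul, ← Real.sqrt_mul (by linarith)]; congr 2; ring
  rw [legendreFactor, legendreFactor, h, show (μ + n) / 2 = μ / 2 + n * (1 / 2) by ring,
    show ν + n - (μ / 2 + n * (1 / 2)) = ν - μ / 2 + n * (1 / 2) by ring,
    ofReal_cpow_add_nat_mul_half (by linarith), ofReal_cpow_add_nat_mul_half (by linarith),
    neg_add, Complex.cpow_add _ _ two_ne_zero, Complex.cpow_neg 2 (n : ℂ), Complex.cpow_natCast,
    div_pow, mul_pow]
  ring

lemma legendreP_eq (ν μ : ℂ) {x : ℝ} (hx1 : x < 1) :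
    legendreP ν μ x = legendreFactor ν μ x *
      regularizedHypergeometric (-ν) (μ - ν) (1 + μ) (-(((1 - x) / (1 + x) : ℝ) : ℂ)) := by
  rw [legendreP, legendreFactor, abs_of_pos (by linarith), ← Complex.ofReal_neg]
  congr 3
  rw [← neg_div, neg_sub, add_comm 1 x]

lemma ofReal_div_cpow {a x : ℝ} (ha : 0 ≤ a) (hx : 0 < x) (s : ℂ) :
    ((a / x : ℝ) : ℂ) ^ s = (a : ℂ) ^ s * (x : ℂ) ^ (-s) := by
  rw [div_eq_mul_inv, Complex.ofReal_mul, Complex.mul_cpow_ofReal_nonneg ha (by positivity),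
    Complex.ofReal_inv, Complex.inv_cpow _ _ (by
      rw [Complex.arg_ofReal_of_nonneg hx.le]; exact Real.pi_ne_zero.symm), Complex.cpow_neg]

lemma legendreP_one_div_eq (ν μ : ℂ) {x : ℝ} (hx0 : 0 < x) (hx1 : x < 1) :
    legendreP ν μ (1 / x) = (x : ℂ) ^ (-ν) * legendreFactor ν μ x *
      regularizedHypergeometric (-ν) (μ - ν) (1 + μ) (((1 - x) / (1 + x) : ℝ) : ℂ) := by
  have h1 : |1 - 1 / x| = (1 - x) / x := by
    rw [abs_sub_comm, abs_of_nonneg]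
    · field_simp
    · rw [sub_nonneg, le_div_iff₀ hx0]; linarith
  have h2 : 1 + 1 / x = (1 + x) / x := by field_simp; ring
  have h3 : (1 / x - 1) / (1 / x + 1) = (1 - x) / (1 + x) := by field_simp
  have h4 : (x : ℂ) ^ (-ν) = (x : ℂ) ^ (-(μ / 2)) * (x : ℂ) ^ (-(ν - μ / 2)) := by
    rw [← Complex.cpow_add _ _ (by exact_mod_cast hx0.ne')]; congr 1; ring
  rw [legendreP, h1, h2, h3, ofReal_div_cpow (by linarith) hx0, ofReal_div_cpow (by linarith) hx0,
    legendreFactor, h4]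
  ring

lemma legendreSeriesCoeff_eq (s ν μ : ℂ) (x : ℝ) (n : ℕ) :
    legendreSeriesCoeff s ν μ x n =
      legendreWeight ν μ n * s ^ n * (Real.sqrt (1 - x ^ 2) : ℂ) ^ n := by
  rw [legendreSeriesCoeff, Complex.ofReal_pow]; rfl

lemma hasSum_of_eq_const_mul {f g : ℕ → ℂ} {a b c : ℂ} (hg : HasSum g b)
    (hf : ∀ n, f n = c * g n) (ha : a = c * b) : HasSum f a :=
  ha ▸ (hg.mul_left c).congr_fun hf

lemma ofReal_sqrt_one_sub_sq_pow {x : ℝ} (hx : |x| ≤ 1) (n : ℕ) :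
    (Real.sqrt (1 - x ^ 2) : ℂ) ^ n * (Real.sqrt (1 - x ^ 2) : ℂ) ^ n =
      ((1 - x ^ 2 : ℝ) : ℂ) ^ n := by
  rw [← mul_pow, ← sq, ← Complex.ofReal_pow,
    Real.sq_sqrt (sub_nonneg.2 ((sq_le_one_iff_abs_le_one x).2 hx))]

theorem hasSum_legendreP_one_div (ν μ : ℂ) {x : ℝ} (hx0 : 0 < x) (hx1 : x < 1) :
    HasSum
      (fun n : ℕ => legendreSeriesCoeff 2 ν μ x n * legendreP (ν + n) (μ + n) x)
      (legendreP ν μ (1 / x) / (x : ℂ) ^ (ν + 1)) := by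
  have hx : (x : ℂ) ≠ 0 := by exact_mod_cast hx0.ne'
  obtain ⟨t, ht⟩ : ∃ t : ℝ, t = (1 - x) / (1 + x) := ⟨_, rfl⟩
  have ht0 : 0 < t := by rw [ht]; exact div_pos (by linarith) (by linarith)
  have ht1 : t < 1 := by rw [ht, div_lt_one (by linarith)]; linarith
  have htx : 1 - t = (1 + t) * x := by rw [ht]; field_simp; ring
  have hw : 4 * t / (1 + t) ^ 2 = 1 - x ^ 2 := by rw [ht]; field_simp; ring
  have hn : ‖(t : ℂ)‖ = t := by simp [abs_of_pos ht0]
  have hn1 : ‖1 + (t : ℂ)‖ = 1 + t := by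
    rw [← Complex.ofReal_one, ← Complex.ofReal_add, Complex.norm_of_nonneg (by linarith)]
  -- Here `w` is the exact value of `4t/(1+t)²`, and it is below `1` for every `x` in `(0, 1)`.
  have key := hasSum_legendreTerm ν μ (w := 1 - x ^ 2) (y := (t : ℂ)) (by nlinarith)
    (fun r hr0 hr1 => summable_legendreWeight_mul_majorant ν μ hr0 hr1 (by nlinarith)
      (by nlinarith)) (by rwa [hn])
    (by rw [hn, hn1, ← hw]; field_simp; rfl)
  refine hasSum_of_eq_const_mul (c := legendreFactor ν μ x) key (fun n => ?_) ?_
  · rw [legendreSeriesCoeff_eq, legendreP_eq _ _ hx1, legendreFactor_add_natCast ν μ hx0 hx1,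
      legendreTerm, show -(ν + n) = -ν - n by ring, show μ + n - (ν + n) = μ - ν by ring,
      ← add_assoc, ← ht]
    have h := ofReal_sqrt_one_sub_sq_pow (abs_le.2 ⟨by linarith, hx1.le⟩) n
    have h2 : 4 * (t : ℂ) / (1 + t) ^ 2 = ((1 - x ^ 2 : ℝ) : ℂ) := by
      rw [← hw]; push_cast; rfl
    rw [h2, ← h, div_pow]
    field_simp
  · rw [legendreSum_eq ν μ (by rwa [hn]), legendreP_one_div_eq ν μ hx0 hx1, ← ht]
    have h1 : ((1 - t : ℂ)) = ((1 + t : ℝ) : ℂ) * (x : ℂ) := by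
      rw [← Complex.ofReal_mul, ← htx]; push_cast; rfl
    have h2 : (1 + t : ℂ) = ((1 + t : ℝ) : ℂ) := by push_cast; rfl
    have h3 : ((1 + t : ℝ) : ℂ) ≠ 0 := by exact_mod_cast (by linarith : 1 + t ≠ 0)
    rw [h1, h2, Complex.mul_cpow_ofReal_nonneg (by linarith) hx0.le,
      ← mul_assoc (((1 + t : ℝ) : ℂ) ^ (2 * ν + 1)), ← Complex.cpow_add _ _ h3, add_neg_cancel, Complex.cpow_zero, one_mul,
      show -(2 * ν + 1) = -ν - (ν + 1) by ring, Complex.cpow_sub _ _ hx]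
    ring

theorem hasSum_legendreP (ν μ : ℂ) {x : ℝ} (hx0 : 0 < x) (hx1 : x < 1)
    (h : 1 / Real.sqrt 2 < x ∨ (x = 1 / Real.sqrt 2 ∧ (3 * ν - μ).re < -1) ∨
      (∃ k : ℕ, 1 ≤ k ∧ -ν = k) ∨ (∃ k : ℕ, -((μ + ν + 1) / 2) = k)) :
    HasSum
      (fun n : ℕ => legendreSeriesCoeff (-2) ν μ x n / (x : ℂ) ^ (ν + n + 1) *
        legendreP (ν + n) (μ + n) (1 / x))
      (legendreP ν μ x) := by
  have hx : (x : ℂ) ≠ 0 := by exact_mod_cast hx0.ne'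
  obtain ⟨t, ht⟩ : ∃ t : ℝ, t = (1 - x) / (1 + x) := ⟨_, rfl⟩
  have ht0 : 0 < t := by rw [ht]; exact div_pos (by linarith) (by linarith)
  have ht1 : t < 1 := by rw [ht, div_lt_one (by linarith)]; linarith
  have htx : 1 - t = (1 + t) * x := by rw [ht]; field_simp; ring
  have h1t : 1 - t ≠ 0 := by linarith
  have hw : 4 * t / (1 - t) ^ 2 = (1 - x ^ 2) / x ^ 2 := by
    rw [htx, ht]; field_simp; ring
  have hn : ‖-(t : ℂ)‖ = t := by simp [abs_of_pos ht0]
  have hn1 : ‖1 + -(t : ℂ)‖ = 1 - t := by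
    rw [← sub_eq_add_neg, ← Complex.ofReal_one, ← Complex.ofReal_sub,
      Complex.norm_of_nonneg (by linarith)]
  have hs2 : (1 / Real.sqrt 2) ^ 2 = 1 / 2 := by
    rw [div_pow, Real.sq_sqrt zero_le_two, one_pow]
  have hw0 : 0 < (1 - x ^ 2) / x ^ 2 := div_pos (by nlinarith) (by positivity)
  -- The alternatives on `x`, `ν`, `μ` enter only here: `w = (1-x²)/x²` is below `1` for `x > 1/√2`,
  -- equals `1` at `x = 1/√2`, and is arbitrary when the series terminates.
  have hsum : ∀ r : ℝ, 0 ≤ r → r < 1 → Summable fun n : ℕ =>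
      ‖legendreWeight ν μ n‖ * legendreMajorant ν μ r n * ((1 - x ^ 2) / x ^ 2) ^ n := by
    intro r hr0 hr1
    rcases h with h | ⟨h, hre⟩ | h
    · refine summable_legendreWeight_mul_majorant ν μ hr0 hr1 hw0.le ?_
      have : (1 / Real.sqrt 2) ^ 2 < x ^ 2 := pow_lt_pow_left₀ h (by positivity) two_ne_zero
      rw [div_lt_one (by positivity)]
      linarith
    · rw [h, hs2, show (1 - 1 / 2) / (1 / 2) = (1 : ℝ) by norm_num]
      exact summable_legendreWeight_mul_majorant_one hre hr0 hr1
    · exact summable_legendreWeight_mul_majorant_of_terminating h r _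
  have key := hasSum_legendreTerm ν μ (y := -(t : ℂ)) hw0 hsum (by rwa [hn])
    (by rw [hn, hn1, ← hw]; field_simp; rfl)
  -- At `z = -t` the quotient `(1+z)/(1-z)` is `x`, so `legendreSum` carries the factor `x^(2ν+1)`,
  -- which the constant removes.
  refine hasSum_of_eq_const_mul (c := legendreFactor ν μ x * (x : ℂ) ^ (-(2 * ν + 1))) key (fun n => ?_) ?_
  · rw [legendreSeriesCoeff_eq, legendreP_one_div_eq _ _ hx0 hx1,
      legendreFactor_add_natCast ν μ hx0 hx1,
      legendreTerm, show -(ν + n) = -ν - n by ring, show μ + n - (ν + n) = μ - ν by ring,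
      ← add_assoc, ← ht, neg_neg]
    have h := ofReal_sqrt_one_sub_sq_pow (abs_le.2 ⟨by linarith, hx1.le⟩) n
    have h2 : 4 * -(t : ℂ) / (1 + -t) ^ 2 = -(((1 - x ^ 2 : ℝ) : ℂ) / (x : ℂ) ^ 2) := by
      rw [← Complex.ofReal_pow x, ← Complex.ofReal_div, ← hw]
      push_cast
      ring
    have h3 : (x : ℂ) ^ (-ν - n) / (x : ℂ) ^ (ν + n + 1) =
        (x : ℂ) ^ (-(2 * ν + 1)) / ((x : ℂ) ^ 2) ^ n := by
      rw [← Complex.cpow_sub _ _ hx, ← pow_mul, ← Complex.cpow_natCast, ← Complex.cpow_sub _ _ hx]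
      congr 1
      push_cast
      ring
    rw [h2, neg_pow (_ / _), div_pow, div_pow, ← h, neg_pow 2]
    calc _ = legendreWeight ν μ n * (-1) ^ n *
          ((x : ℂ) ^ (-ν - n) / (x : ℂ) ^ (ν + n + 1)) * legendreFactor ν μ x *
          ((Real.sqrt (1 - x ^ 2) : ℂ) ^ n * (Real.sqrt (1 - x ^ 2) : ℂ) ^ n) *
          regularizedHypergeometric (-ν - n) (μ - ν) (1 + μ + n) t := by
            field_simp
      _ = _ := by rw [h3]; ring
  · rw [legendreSum_eq ν μ (by rwa [hn]), legendreP_eq ν μ hx1, ← ht]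
    have h1 : (1 + -t : ℂ) = ((1 + t : ℝ) : ℂ) * (x : ℂ) := by
      rw [← Complex.ofReal_mul, ← htx]; push_cast; ring
    have h2 : (1 - -t : ℂ) = ((1 + t : ℝ) : ℂ) := by push_cast; ring
    have h3 : ((1 + t : ℝ) : ℂ) ≠ 0 := by exact_mod_cast (by linarith : 1 + t ≠ 0)
    have h4 : ((1 + t : ℝ) : ℂ) ^ (2 * ν + 1) ≠ 0 := fun h =>
      h3 ((Complex.cpow_eq_zero_iff _ _).1 h).1
    have h5 : (x : ℂ) ^ (2 * ν + 1) ≠ 0 := fun h =>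
      hx ((Complex.cpow_eq_zero_iff _ _).1 h).1
    rw [h1, h2, Complex.mul_cpow_ofReal_nonneg (by linarith) hx0.le, Complex.cpow_neg,
      Complex.cpow_neg]
    generalize ((1 + t : ℝ) : ℂ) ^ (2 * ν + 1) = c at *
    generalize (x : ℂ) ^ (2 * ν + 1) = d at *
    field_simp

theorem theorem4 (μ ν : ℂ) (x : ℝ) (hx0 : 0 < x) (hx1 : x < 1) :
    -- the Ferrers function as a series of associated Legendre functions of `1 / x`
    ((1 / Real.sqrt 2 < x ∨
        (x = 1 / Real.sqrt 2 ∧ (3 * ν - μ).re < -1) ∨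
        (∃ k : ℕ, 1 ≤ k ∧ -ν = k) ∨
        (∃ k : ℕ, -((μ + ν + 1) / 2) = k)) →
      HasSum
        (fun n : ℕ => legendreSeriesCoeff (-2) ν μ x n / (x : ℂ) ^ (ν + n + 1) *
          legendreP (ν + n) (μ + n) (1 / x))
        (legendreP ν μ x)) ∧
    -- the associated Legendre function of `1 / x` as a series of Ferrers functions
    HasSum
      (fun n : ℕ => legendreSeriesCoeff 2 ν μ x n * legendreP (ν + n) (μ + n) x)
      (legendreP ν μ (1 / x) / (x : ℂ) ^ (ν + 1)) ∧
    -- the two series are mutually inverse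
    (∀ N : ℕ, ∑ j ∈ Finset.range (N + 1),
      legendreSeriesCoeff (-2) ν μ x j * legendreSeriesCoeff 2 (ν + j) (μ + j) x (N - j) =
        if N = 0 then 1 else 0) ∧
    (∀ N : ℕ, ∑ j ∈ Finset.range (N + 1),
      legendreSeriesCoeff 2 ν μ x j * legendreSeriesCoeff (-2) (ν + j) (μ + j) x (N - j) =
        if N = 0 then 1 else 0) := by
  refine ⟨hasSum_legendreP ν μ hx0 hx1, hasSum_legendreP_one_div ν μ hx0 hx1, fun N => ?_,
    fun N => ?_⟩
  · simpa using sum_legendreSeriesCoeff_mul (-2) ν μ x N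
  · exact sum_legendreSeriesCoeff_mul 2 ν μ x N
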